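/- Let $d\ge 1$. Discrete-time internal DLA on $\mathbb Z^d$ is the random growing family of sets $A_0=\emptyset$, $A_{n+1}=A_n\cup\{x_n\}$, where $x_n$ is the first site outside $A_n$ visited by the $n$-th of a sequence of independent simple random walks on $\mathbb Z^d$ started at the origin (so $A_1=\{0\}$). Let $T(t)$, $t\ge 0$, be the counting function of a rate-one Poisson point process on $[0,\infty)$, independent of the walks, so that $T(t)$ is the number of its points in $[0,t]$; the sets $A_{T(t)}$, $t\ge0$, form continuous-time internal DLA. Let $\Omega$ be the set of functions $f:[0,\infty)\times\mathbb Z^d\to\{0,1\}$ with $f(t,x)\le f(t',x)$ whenever $t\le t'$, endowed with the coordinatewise partial order and the product $\sigma$-algebra, and let $\mathbb P$ be the law on $\Omega$ of the random function $(t,x)\mapsto \mathbf 1_{\{x\in A_{T(t)}\}}$, which is also denoted $\{A_{T(t)}\}_{t\ge0}$. If $F,G:\Omega\to\mathbb R$ are increasing (that is, $f\le g$ implies $F(f)\le F(g)$ and $G(f)\le G(g)$) and $F,G\in L^2(\Omega,\mathbb P)$, then the random variables $F(\{A_{T(t)}\}_{t\ge0})$ and $G(\{A_{T(t)}\}_{t\ge0})$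 are nonnegatively correlated: $$\operatorname{Cov}\bigl(F(\{A_{T(t)}\}_{t\ge0}),\,G(\{A_{T(t)}\}_{t\ge0})\bigr)\ge 0.$$ -/

import Mathlib

open MeasureTheory ProbabilityTheory
open scoped NNReal

namespace IDLA

/-- The lattice `ℤ^d`. -/
abbrev Site (d : ℕ) : Type := Fin d → ℤ

/-- The `2d` unit vectors `± e_i` of `ℤ^d`. -/
def unitSteps (d : ℕ) : Set (Site d) :=
  {v | ∃ i, v = Pi.single i 1 ∨ v = -Pi.single i 1}

/-- The functions `f : [0,∞) × ℤ^d → {0,1}` that are nondecreasing in time. As a subtype of a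
product it carries the coordinatewise order and the product `σ`-algebra. -/
abbrev History (d : ℕ) : Type :=
  {f : ℝ≥0 × Site d → Fin 2 // ∀ (x : Site d) (t t' : ℝ≥0), t ≤ t' → f (t, x) ≤ f (t', x)}

/-- The position after `k` steps of the walk from the origin with the given steps. -/
def walk {d : ℕ} (steps : ℕ → Site d) (k : ℕ) : Site d :=
  ∑ j ∈ Finset.range k, steps j

/-- The internal DLA clusters: `A_0 = ∅`, and `A_{n+1}` is the union of `A_n` and the first place
where the `n`-th walk is outside `A_n` (nothing is added if the walk never leaves `A_n`). -/
def cluster {d : ℕ} (steps : ℕ → ℕ → Site d) : ℕ → Set (Site d)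
  | 0 => ∅
  | n + 1 => cluster steps n ∪
      {x | ∃ k, walk (steps n) k = x ∧ x ∉ cluster steps n ∧
        ∀ j < k, walk (steps n) j ∈ cluster steps n}

theorem cluster_mono {d : ℕ} (steps : ℕ → ℕ → Site d) : Monotone (cluster steps) :=
  monotone_nat_of_le_succ fun _ => Set.subset_union_left

/-- A rate-one Poisson process on `[0,∞)`, given by its counting function: `T t` is the number of
points in `[0,t]`. -/
structure IsPoissonProcess {S : Type*} [MeasurableSpace S] (T : ℝ≥0 → S → ℕ) (μ : Measure S) :
    Prop where
  measurable : ∀ t, Measurable (T t)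
  zero : ∀ ω, T 0 ω = 0
  monotone : ∀ ω, Monotone fun t => T t ω
  rightContinuous : ∀ ω t, ContinuousWithinAt (fun s => T s ω) (Set.Ici t) t
  hasLaw_increment : ∀ s t, s ≤ t → HasLaw (fun ω => T t ω - T s ω) (poissonMeasure (t - s)) μ
  hasIndepIncrements : HasIndepIncrements T μ

/-- `X n k` is the `k`-th step of the `n`-th walk; all steps of all walks are independent and
uniform on the unit vectors, that is, `walk (X n · ω)`, `n ∈ ℕ`, are independent simple random
walks from the origin. -/
structure IsSimpleWalkSteps {S : Type*} [MeasurableSpace S] {d : ℕ}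
    (X : ℕ → ℕ → S → Site d) (μ : Measure S) : Prop where
  measurable : ∀ n k, Measurable (X n k)
  hasLaw : ∀ n k, HasLaw (X n k) (uniformOn (unitSteps d)) μ
  iIndepFun : iIndepFun (fun p : ℕ × ℕ => X p.1 p.2) μ

open Classical in
/-- The history `(t, x) ↦ 1_{x ∈ A_{T(t)}}` of continuous-time internal DLA. -/
noncomputable def history {S : Type*} {d : ℕ} (T : ℝ≥0 → S → ℕ)
    (hT : ∀ ω, Monotone fun t => T t ω) (X : ℕ → ℕ → S → Site d) (ω : S) : History d :=
  ⟨fun p => if p.2 ∈ cluster (fun n k => X n k ω) (T p.1 ω) then 1 else 0, by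
    intro x t t' h
    have hsub := cluster_mono (fun n k => X n k ω) (hT ω h)
    by_cases hx : x ∈ cluster (fun n k => X n k ω) (T t ω)
    · simp [hx, hsub hx]
    · simp [hx]⟩

theorem measurableSet_mem_cluster {S : Type*} [MeasurableSpace S] {d : ℕ}
    {X : ℕ → ℕ → S → Site d} (hX : ∀ n k, Measurable (X n k)) (n : ℕ) :
    ∀ x, MeasurableSet {ω | x ∈ cluster (fun n k => X n k ω) n} := by
  induction n with
  | zero => intro x; simp [cluster]
  | succ n ih =>
    intro x
    have hw : ∀ k, Measurable fun ω => walk (fun j => X n j ω) k := fun k => by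
      unfold walk
      exact Finset.measurable_sum _ fun j _ => hX n j
    have hmem : ∀ k, MeasurableSet
        {ω | walk (fun j => X n j ω) k ∈ cluster (fun n k => X n k ω) n} := fun k => by
      have : {ω | walk (fun j => X n j ω) k ∈ cluster (fun n k => X n k ω) n} =
          ⋃ y : Site d, {ω | walk (fun j => X n j ω) k = y} ∩
            {ω | y ∈ cluster (fun n k => X n k ω) n} := by
        ext ω; simp
      rw [this]
      exact MeasurableSet.iUnion fun y => ((hw k) (measurableSet_singleton y)).inter (ih y)
    have : {ω | x ∈ cluster (fun n k => X n k ω) (n + 1)} =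
        {ω | x ∈ cluster (fun n k => X n k ω) n} ∪
          ⋃ k : ℕ, ({ω | walk (fun j => X n j ω) k = x} ∩
            ({ω | x ∈ cluster (fun n k => X n k ω) n}ᶜ ∩
              ⋂ j : ℕ, ⋂ _ : j < k,
                {ω | walk (fun j => X n j ω) j ∈ cluster (fun n k => X n k ω) n})) := by
      ext ω; simp [cluster]
    rw [this]
    exact (ih x).union (MeasurableSet.iUnion fun k =>
      ((hw k) (measurableSet_singleton x)).inter ((ih x).compl.inter
        (MeasurableSet.iInter fun j => MeasurableSet.iInter fun _ => hmem j)))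

/-- The history is a random element of `History d`, so that its law `μ.map` is meaningful. -/
theorem measurable_history {S : Type*} [MeasurableSpace S] {d : ℕ} {T : ℝ≥0 → S → ℕ}
    (hT : ∀ ω, Monotone fun t => T t ω) {X : ℕ → ℕ → S → Site d}
    (hTm : ∀ t, Measurable (T t)) (hX : ∀ n k, Measurable (X n k)) :
    Measurable (history T hT X) := by
  classical
  refine Measurable.subtype_mk (measurable_pi_lambda _ fun p => ?_)
  refine Measurable.ite ?_ measurable_const measurable_const
  have : {ω | p.2 ∈ cluster (fun n k => X n k ω) (T p.1 ω)} =
      ⋃ n : ℕ, {ω | T p.1 ω = n} ∩ {ω | p.2 ∈ cluster (fun n k => X n k ω) n} := by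
    ext ω; simp
  rw [this]
  exact MeasurableSet.iUnion fun n =>
    ((hTm p.1) (measurableSet_singleton n)).inter (measurableSet_mem_cluster hX n p.2)

end IDLA

/-! Let f and g be bounded increasing functions of the history, with bound M, and cut time into
short blocks. Fix the past of a block of length h. With probability exp(-h) ≥ 1 - h nobody arrives
during the block, and then the conditional means of f and g at its end take constant values a and b.
These are (almost surely) their minima: arrivals only enlarge the cluster, and the enlargement
persists if the same walks are used afterwards (`grow_mono`, `pathHistory_splice_splice_le`).
Writing f and g also for these conditional means, E[(f-a)(g-b)] ≥ 0 gives E[fg] ≥ E[f]E[g] -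
(E[f]-a)(E[g]-b). Both factors are at most 2Mh, since f-a and g-b vanish off an event of probability
at most h. A block therefore costs at most (2Mh)² (`integral_futureMean_mul_le`). Block lengths
c/(i+1) exhaust [0,∞) at total cost O(c²), martingale convergence recovers f and g
(`ae_tendsto_futureMean`), and c → 0 removes the error. The walks matter only through monotonicity
of growth; no correlation inequality for them is needed.

Independence of past and future is expressed by `splice`: following a path up to time s and then an
independent copy, with the walks renumbered from the number already used, preserves the law
(`IsPoissonClock.measurePreserving_splice`). Increasing functions are only almost everywhere
measurable here, so order arguments use `F` and integrals use a measurable version `Φ`. Truncation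
reduces square integrable functions to bounded ones. -/

namespace IDLA

/-! ### Growing a cluster from an arbitrary initial set -/

/-- The set `A` together with the first place where the given walk is outside `A`. -/
def grow {d : ℕ} (A : Set (Site d)) (steps : ℕ → Site d) : Set (Site d) :=
  A ∪ {x | ∃ k, walk steps k = x ∧ x ∉ A ∧ ∀ j < k, walk steps j ∈ A}

/-- The internal DLA clusters started from the set `A`. -/
def clusterFrom {d : ℕ} (w : ℕ × ℕ → Site d) (A : Set (Site d)) : ℕ → Set (Site d)
  | 0 => A
  | n + 1 => grow (clusterFrom w A n) fun k => w (n, k)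

/-- Before its first exit from `A` the walk is in `A`, hence in `B`; so the exit point either lies
in `B` or is also the first exit point from `B`. -/
theorem grow_mono {d : ℕ} {A B : Set (Site d)} (h : A ⊆ B) (v : ℕ → Site d) :
    grow A v ⊆ grow B v := by
  rintro x (hx | ⟨k, hk, -, hj⟩)
  · exact Or.inl (h hx)
  · by_cases hxB : x ∈ B
    · exact Or.inl hxB
    · exact Or.inr ⟨k, hk, hxB, fun j hjk => h (hj j hjk)⟩

theorem clusterFrom_mono {d : ℕ} (w : ℕ × ℕ → Site d) {A B : Set (Site d)} (h : A ⊆ B) (n : ℕ) :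
    clusterFrom w A n ⊆ clusterFrom w B n := by
  induction n with
  | zero => exact h
  | succ n ih => exact grow_mono ih _

theorem subset_clusterFrom {d : ℕ} (w : ℕ × ℕ → Site d) (A : Set (Site d)) (n : ℕ) :
    A ⊆ clusterFrom w A n := by
  induction n with
  | zero => exact subset_rfl
  | succ n ih => exact ih.trans Set.subset_union_left

theorem cluster_eq_clusterFrom {d : ℕ} (w : ℕ × ℕ → Site d) (n : ℕ) :
    cluster (fun n k => w (n, k)) n = clusterFrom w ∅ n := by
  induction n with
  | zero => rfl
  | succ n ih => simp only [cluster, clusterFrom, grow, ih]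

/-! ### Clocks, paths and their concatenation -/

/-- Counting functions of locally finite point configurations on `(0,∞)`. -/
abbrev Clock : Type := {T : ℝ≥0 → ℕ // Monotone T ∧ T 0 = 0}

/-- The steps of all walks. -/
abbrev Steps (d : ℕ) : Type := ℕ × ℕ → Site d

/-- The data that determine a history of continuous-time internal DLA. -/
abbrev Path (d : ℕ) : Type := Clock × Steps d

/-- The history determined by a path. -/
noncomputable def pathHistory {d : ℕ} : Path d → History d :=
  history (fun t e => e.1.1 t) (fun e => e.1.2.1) (fun n k e => e.2 (n, k))

/-- The cluster at time `t`. -/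
def clusterAt {d : ℕ} (e : Path d) (t : ℝ≥0) : Set (Site d) := clusterFrom e.2 ∅ (e.1.1 t)

open Classical in
theorem pathHistory_apply {d : ℕ} (e : Path d) (p : ℝ≥0 × Site d) :
    (pathHistory e).1 p = if p.2 ∈ clusterAt e p.1 then 1 else 0 := by
  simp only [pathHistory, history, clusterAt, cluster_eq_clusterFrom]
  congr

theorem pathHistory_le {d : ℕ} {e e' : Path d} (h : ∀ t, clusterAt e t ⊆ clusterAt e' t) :
    pathHistory e ≤ pathHistory e' := by
  intro p
  rw [pathHistory_apply, pathHistory_apply]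
  by_cases hp : p.2 ∈ clusterAt e p.1
  · simp [hp, h p.1 hp]
  · simp [hp]

theorem measurable_clock_apply (t : ℝ≥0) : Measurable fun T : Clock => T.1 t :=
  (measurable_pi_apply t).comp measurable_subtype_coe

theorem measurable_pathHistory {d : ℕ} : Measurable (pathHistory (d := d)) :=
  measurable_history _ (fun t => (measurable_clock_apply t).comp measurable_fst)
    fun n k => (measurable_pi_apply (n, k)).comp measurable_snd

/-- The clock that follows `T` up to time `s` and afterwards has the increments of `T'`. -/
def spliceClock (s : ℝ≥0) (T T' : Clock) : Clock :=
  ⟨fun t => T.1 (min t s) + T'.1 (t - s),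
    fun _ _ h => add_le_add (T.2.1 (min_le_min_right s h)) (T'.2.1 (tsub_le_tsub_right h s)),
    by simp [T.2.2, T'.2.2]⟩

/-- The first `m` walks of `w` followed by the walks of `w'`. -/
def spliceSteps {d : ℕ} (m : ℕ) (w w' : Steps d) : Steps d :=
  fun p => if p.1 < m then w p else w' (p.1 - m, p.2)

/-- The path that follows `e` up to time `s` and the path `e'` afterwards. -/
def splice {d : ℕ} (s : ℝ≥0) (e e' : Path d) : Path d :=
  (spliceClock s e.1 e'.1, spliceSteps (e.1.1 s) e.2 e'.2)

theorem spliceClock_spliceClock (s h : ℝ≥0) (T T' T'' : Clock) :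
    spliceClock (s + h) (spliceClock s T T') T'' =
      spliceClock s T (spliceClock h T' T'') := by
  refine Subtype.ext (funext fun t => ?_)
  have h1 : min (min t (s + h)) s = min t s := by
    rw [min_assoc, min_eq_right le_self_add]
  have h2 : min t (s + h) - s = min (t - s) h := by
    rcases le_total t (s + h) with ht | ht
    · rw [min_eq_left ht, min_eq_left (tsub_le_iff_left.2 ht)]
    · rw [min_eq_right ht, min_eq_right (le_tsub_of_add_le_left ht), add_tsub_cancel_left]
  simp only [spliceClock, h1, h2, add_assoc, tsub_add_eq_tsub_tsub]

theorem spliceSteps_spliceSteps {d : ℕ} (m n : ℕ) (w w' w'' : Steps d) :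
    spliceSteps (m + n) (spliceSteps m w w') w'' =
      spliceSteps m w (spliceSteps n w' w'') := by
  funext p
  simp only [spliceSteps]
  by_cases h1 : p.1 < m
  · simp [h1, Nat.lt_add_right n h1]
  · by_cases h2 : p.1 < m + n
    · have : p.1 - m < n := by omega
      simp [h1, h2, this]
    · have : ¬ p.1 - m < n := by omega
      simp [h1, h2, this, Nat.sub_sub]

/-- Associativity of concatenation is the tower property at the level of paths. -/
theorem splice_splice {d : ℕ} (s h : ℝ≥0) (e e' e'' : Path d) :
    splice (s + h) (splice s e e') e'' = splice s e (splice h e' e'') := by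
  refine Prod.ext (spliceClock_spliceClock s h _ _ _) ?_
  have : (splice s e e').1.1 (s + h) = e.1.1 s + e'.1.1 h := by
    simp [splice, spliceClock]
  simp only [splice] at this ⊢
  rw [this, spliceSteps_spliceSteps]

/-- A change after `s'` is invisible to a path cut at an earlier time. This makes the pasts a
filtration and the future means adapted to it. -/
theorem splice_splice_of_le {d : ℕ} {s s' : ℝ≥0} (h : s ≤ s') (e e' e'' : Path d) :
    splice s (splice s' e e') e'' = splice s e e'' := by
  refine Prod.ext (Subtype.ext (funext fun t => ?_)) (funext fun p => ?_)
  · have h1 : min t s - s' = 0 := tsub_eq_zero_of_le ((min_le_right _ _).trans h)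
    have h2 : min (min t s) s' = min t s := min_eq_left ((min_le_right _ _).trans h)
    simp [splice, spliceClock, h1, h2, e'.1.2.2]
  · have h1 : p.1 < e.1.1 s → p.1 < e.1.1 s' := fun hp => hp.trans_le (e.1.2.1 h)
    simp only [splice, spliceSteps, spliceClock, min_eq_left h, tsub_eq_zero_of_le h, e'.1.2.2,
      add_zero]
    by_cases hp : p.1 < e.1.1 s
    · simp [hp, h1 hp]
    · simp [hp]

theorem splice_zero {d : ℕ} (e e' : Path d) : splice 0 e e' = e' := by
  refine Prod.ext (Subtype.ext (funext fun t => ?_)) (funext fun p => ?_)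
  · simp [splice, spliceClock, e.1.2.2]
  · simp [splice, spliceSteps, e.1.2.2]

theorem clusterFrom_spliceSteps_of_le {d : ℕ} {m n : ℕ} (h : n ≤ m) (w w' : Steps d)
    (A : Set (Site d)) : clusterFrom (spliceSteps m w w') A n = clusterFrom w A n := by
  induction n with
  | zero => rfl
  | succ n ih =>
    have hn : n < m := h
    simp only [clusterFrom, ih hn.le]
    simp [spliceSteps, hn]

theorem clusterFrom_spliceSteps_add {d : ℕ} (m n : ℕ) (w w' : Steps d) (A : Set (Site d)) :
    clusterFrom (spliceSteps m w w') A (m + n) = clusterFrom w' (clusterFrom w A m) n := by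
  induction n with
  | zero => exact clusterFrom_spliceSteps_of_le le_rfl w w' A
  | succ n ih =>
    rw [← add_assoc]
    simp only [clusterFrom, ih]
    simp [spliceSteps]

theorem clusterAt_splice {d : ℕ} (s : ℝ≥0) (e e' : Path d) (t : ℝ≥0) :
    clusterAt (splice s e e') t = clusterFrom e'.2 (clusterAt e (min t s)) (e'.1.1 (t - s)) := by
  simp only [clusterAt, splice, spliceClock]
  rcases le_total t s with h | h
  · rw [min_eq_left h, tsub_eq_zero_of_le h, e'.1.2.2, add_zero,
      clusterFrom_spliceSteps_of_le (e.1.2.1 h)]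
    rfl
  · rw [min_eq_right h, clusterFrom_spliceSteps_add]

/-- A path with some arrivals before time `h` gives a larger history than one without. -/
theorem pathHistory_splice_splice_le {d : ℕ} (s h : ℝ≥0) (e e₀ e' e'' : Path d)
    (h₀ : e₀.1.1 h = 0) :
    pathHistory (splice (s + h) (splice s e e₀) e'') ≤
      pathHistory (splice (s + h) (splice s e e') e'') := by
  refine pathHistory_le fun t => ?_
  simp only [clusterAt_splice]
  refine clusterFrom_mono _ ?_ _
  have hle : min t (s + h) - s ≤ h := by
    rw [tsub_le_iff_left]; exact min_le_right _ _
  have h0 : e₀.1.1 (min t (s + h) - s) = 0 := Nat.le_zero.1 ((e₀.1.2.1 hle).trans h₀.le)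
  rw [h0]
  exact subset_clusterFrom _ _ _

/-! ### Measurability of the concatenation -/

theorem measurable_spliceClock (s : ℝ≥0) :
    Measurable fun p : Clock × Clock => spliceClock s p.1 p.2 := by
  refine Measurable.subtype_mk (measurable_pi_lambda _ fun t => ?_)
  exact ((measurable_clock_apply _).comp measurable_fst).add
    ((measurable_clock_apply _).comp measurable_snd)

theorem measurable_spliceSteps {d : ℕ} :
    Measurable fun q : ℕ × (Steps d × Steps d) => spliceSteps q.1 q.2.1 q.2.2 := by
  refine measurable_from_prod_countable_right fun m => measurable_pi_lambda _ fun p => ?_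
  by_cases h : p.1 < m
  · simp only [spliceSteps, h, if_true]
    exact (measurable_pi_apply p).comp measurable_fst
  · simp only [spliceSteps, h, if_false]
    exact (measurable_pi_apply (p.1 - m, p.2)).comp measurable_snd

theorem measurable_splice {d : ℕ} (s : ℝ≥0) :
    Measurable fun p : Path d × Path d => splice s p.1 p.2 := by
  refine Measurable.prodMk ?_ ?_
  · exact (measurable_spliceClock s).comp
      ((measurable_fst.comp measurable_fst).prodMk (measurable_fst.comp measurable_snd))
  · exact measurable_spliceSteps.comp
      (((measurable_clock_apply s).comp (measurable_fst.comp measurable_fst)).prodMk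
        ((measurable_snd.comp measurable_fst).prodMk (measurable_snd.comp measurable_snd)))

/-! ### Product measures -/

theorem map_sumElim_infinitePi {κ₁ κ₂ Y : Type*} [MeasurableSpace Y]
    (m₁ : κ₁ → Measure Y) (m₂ : κ₂ → Measure Y) [∀ i, IsProbabilityMeasure (m₁ i)]
    [∀ i, IsProbabilityMeasure (m₂ i)] [∀ i, IsProbabilityMeasure (Sum.elim m₁ m₂ i)] :
    ((Measure.infinitePi m₁).prod (Measure.infinitePi m₂)).map
      (fun p (i : κ₁ ⊕ κ₂) => Sum.elim p.1 p.2 i) = Measure.infinitePi (Sum.elim m₁ m₂) := by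
  have hm : Measurable fun (p : (κ₁ → Y) × (κ₂ → Y)) (i : κ₁ ⊕ κ₂) => Sum.elim p.1 p.2 i := by
    refine measurable_pi_lambda _ fun i => ?_
    cases i with
    | inl i => exact (measurable_pi_apply i).comp measurable_fst
    | inr i => exact (measurable_pi_apply i).comp measurable_snd
  refine Measure.eq_infinitePi _ fun s t ht => ?_
  have hpre : (fun (p : (κ₁ → Y) × (κ₂ → Y)) (i : κ₁ ⊕ κ₂) => Sum.elim p.1 p.2 i) ⁻¹'
      ((s : Set (κ₁ ⊕ κ₂)).pi t) =
      ((s.toLeft : Set κ₁).pi fun i => t (Sum.inl i)) ×ˢ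
        ((s.toRight : Set κ₂).pi fun i => t (Sum.inr i)) := by
    ext p
    simp [Set.mem_pi]
  rw [Measure.map_apply hm (MeasurableSet.pi s.countable_toSet fun i _ => ht i), hpre,
    Measure.prod_prod, Measure.infinitePi_pi _ fun i _ => ht _,
    Measure.infinitePi_pi _ fun i _ => ht _, Finset.prod_sum_eq_prod_toLeft_mul_prod_toRight]
  rfl

/-- Selecting, without repetition, coordinates of two independent families of independent
variables gives again a family of independent variables. -/
theorem map_select_infinitePi {ι κ₁ κ₂ Y : Type*} [MeasurableSpace Y]
    (m₁ : κ₁ → Measure Y) (m₂ : κ₂ → Measure Y) (m : ι → Measure Y)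
    [∀ i, IsProbabilityMeasure (m₁ i)] [∀ i, IsProbabilityMeasure (m₂ i)]
    {σ : ι → κ₁ ⊕ κ₂} (hσ : Function.Injective σ) (hm : ∀ i, m i = Sum.elim m₁ m₂ (σ i)) :
    ((Measure.infinitePi m₁).prod (Measure.infinitePi m₂)).map
      (fun p i => Sum.elim p.1 p.2 (σ i)) = Measure.infinitePi m := by
  have : ∀ i, IsProbabilityMeasure (Sum.elim m₁ m₂ i) := by
    rintro (i | i) <;> simp only [Sum.elim_inl, Sum.elim_inr] <;> infer_instance
  have hm' : m = fun i => Sum.elim m₁ m₂ (σ i) := funext hm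
  rw [hm', ← Measure.map_infinitePi_infinitePi_of_inj hσ, ← map_sumElim_infinitePi,
    Measure.map_map]
  · rfl
  · exact measurable_pi_lambda _ fun i => measurable_pi_apply _
  · refine measurable_pi_lambda _ fun i => ?_
    cases i with
    | inl i => exact (measurable_pi_apply i).comp measurable_fst
    | inr i => exact (measurable_pi_apply i).comp measurable_snd

theorem measurePreserving_prodProdProdComm {α β γ δ : Type*} [MeasurableSpace α] [MeasurableSpace β]
    [MeasurableSpace γ] [MeasurableSpace δ] (a : Measure α) (b : Measure β) (c : Measure γ)
    (e : Measure δ) [IsProbabilityMeasure a] [IsProbabilityMeasure b] [IsProbabilityMeasure c]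
    [IsProbabilityMeasure e] :
    MeasurePreserving (fun p : (α × β) × (γ × δ) => ((p.1.1, p.2.1), (p.1.2, p.2.2)))
      ((a.prod b).prod (c.prod e)) ((a.prod c).prod (b.prod e)) := by
  have hswap : MeasurePreserving (Prod.swap : β × γ → γ × β) (b.prod c) (c.prod b) :=
    Measure.measurePreserving_swap
  exact (measurePreserving_prodAssoc a c (b.prod e)).symm.comp <|
    ((MeasurePreserving.id a).prod (measurePreserving_prodAssoc c b e)).comp <|
    ((MeasurePreserving.id a).prod (hswap.prod (MeasurePreserving.id e))).comp <|
    ((MeasurePreserving.id a).prod (measurePreserving_prodAssoc b c e).symm).comp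
    (measurePreserving_prodAssoc a b (c.prod e))

/-- The steps law is preserved by concatenation after `m` walks. -/
theorem map_spliceSteps {d : ℕ} (lam : Measure (Site d)) [IsProbabilityMeasure lam]
    (m : ℕ) :
    ((Measure.infinitePi fun _ : ℕ × ℕ => lam).prod (Measure.infinitePi fun _ : ℕ × ℕ => lam)).map
      (fun p => spliceSteps m p.1 p.2) = Measure.infinitePi fun _ : ℕ × ℕ => lam := by
  have hσ : Function.Injective fun p : ℕ × ℕ =>
      (if p.1 < m then Sum.inl p else Sum.inr (p.1 - m, p.2) : (ℕ × ℕ) ⊕ (ℕ × ℕ)) := by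
    rintro ⟨a, b⟩ ⟨a', b'⟩ h
    dsimp only at h
    split_ifs at h with h1 h2 h2
    · exact Sum.inl.inj h
    · have h3 := Sum.inr.inj h
      simp only [Prod.mk.injEq] at h3 ⊢
      omega
  have := map_select_infinitePi (fun _ : ℕ × ℕ => lam) (fun _ : ℕ × ℕ => lam)
    (fun _ : ℕ × ℕ => lam) hσ (fun p => by split_ifs <;> rfl)
  refine Eq.trans ?_ this
  congr 1
  funext p q
  simp only [spliceSteps]
  split_ifs <;> rfl

/-! ### The law of a clock -/

/-- The increments of a clock along a sequence of times. -/
def increments (τ : ℕ → ℝ≥0) (T : Clock) (i : ℕ) : ℕ := T.1 (τ (i + 1)) - T.1 (τ i)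

theorem measurable_increments (τ : ℕ → ℝ≥0) : Measurable (increments τ) :=
  measurable_pi_lambda _ fun _ => (measurable_clock_apply _).sub (measurable_clock_apply _)

theorem sum_increments {τ : ℕ → ℝ≥0} (hτ : Monotone τ) (h0 : τ 0 = 0) (T : Clock) (k : ℕ) :
    ∑ i ∈ Finset.range k, increments τ T i = T.1 (τ k) := by
  simp only [increments]
  rw [Finset.sum_range_tsub (f := fun i => T.1 (τ i)) (T.2.1.comp hτ)]
  simp [h0, T.2.2]

theorem exists_monotone_seq (I : Finset ℝ≥0) :
    ∃ τ : ℕ → ℝ≥0, Monotone τ ∧ τ 0 = 0 ∧ ∀ u ∈ I, ∃ k, τ k = u := by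
  classical
  set J := insert 0 I with hJ
  have hpos : 0 < J.card := Finset.card_pos.2 ⟨0, Finset.mem_insert_self _ _⟩
  have hlt : ∀ i, min i (J.card - 1) < J.card := fun i => by omega
  -- The sequence lists `J` in increasing order and then stays at its maximum.
  refine ⟨fun i => J.orderEmbOfFin rfl ⟨min i (J.card - 1), hlt i⟩, ?_, ?_, ?_⟩
  · intro i j hij
    refine (J.orderEmbOfFin rfl).monotone ?_
    exact min_le_min_right _ hij
  · obtain ⟨k, hk⟩ : (0 : ℝ≥0) ∈ Set.range (J.orderEmbOfFin rfl) := by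
      rw [Finset.range_orderEmbOfFin]; exact Finset.mem_insert_self _ _
    refine le_antisymm ?_ zero_le
    conv_rhs => rw [← hk]
    refine (J.orderEmbOfFin rfl).monotone ?_
    simp [Fin.le_def]
  · intro u hu
    obtain ⟨k, hk⟩ : u ∈ Set.range (J.orderEmbOfFin rfl) := by
      rw [Finset.range_orderEmbOfFin]; exact Finset.mem_insert_of_mem hu
    refine ⟨k, ?_⟩
    rw [← hk]
    exact congrArg (J.orderEmbOfFin rfl) (Fin.ext (min_eq_left (Nat.le_sub_one_of_lt k.2)))

/-- The law of a clock is determined by the laws of its increments. -/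
theorem clock_measure_ext {ρ₁ ρ₂ : Measure Clock} [IsProbabilityMeasure ρ₁]
    [IsProbabilityMeasure ρ₂] (s : ℝ≥0)
    (h : ∀ τ : ℕ → ℝ≥0, Monotone τ → τ 0 = 0 → (∃ k, τ k = s) →
      ρ₁.map (increments τ) = ρ₂.map (increments τ)) : ρ₁ = ρ₂ := by
  classical
  have hval : Measurable (Subtype.val : Clock → ℝ≥0 → ℕ) := measurable_subtype_coe
  suffices H : ρ₁.map Subtype.val = ρ₂.map Subtype.val by
    ext C hC
    obtain ⟨B, hB, rfl⟩ := hC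
    rw [← Measure.map_apply hval hB, H, Measure.map_apply hval hB]
  have hproj : ∀ ρ : Measure Clock, IsProjectiveLimit (ρ.map Subtype.val)
      fun I : Finset ℝ≥0 => ρ.map fun T => I.restrict T.1 := fun ρ I => by
    rw [Measure.map_map (Finset.measurable_restrict I) hval]
    rfl
  have : ∀ I : Finset ℝ≥0, IsFiniteMeasure (ρ₁.map fun T => I.restrict T.1) :=
    fun I => inferInstance
  refine (hproj ρ₁).unique (P := fun I => ρ₁.map fun T => I.restrict T.1) fun I => ?_
  rw [hproj ρ₂ I]
  -- Refining the times by `s` costs nothing and ensures that no increment straddles the splicing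
  -- time.
  obtain ⟨τ, hτ, h0, hk⟩ := exists_monotone_seq (insert s I)
  have hkI : ∀ u : I, ∃ k, τ k = u := fun u => hk u (Finset.mem_insert_of_mem u.2)
  choose k hk' using hkI
  have hfac : (fun T : Clock => I.restrict T.1) =
      (fun (a : ℕ → ℕ) (u : I) => ∑ i ∈ Finset.range (k u), a i) ∘ increments τ := by
    funext T u
    simp only [Function.comp_apply, sum_increments hτ h0, hk', Finset.restrict]
  have hsum : Measurable fun (a : ℕ → ℕ) (u : I) => ∑ i ∈ Finset.range (k u), a i :=
    measurable_pi_lambda _ fun u => Finset.measurable_sum _ fun i _ => measurable_pi_apply i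
  change ρ₂.map (fun T : Clock => I.restrict T.1) = ρ₁.map (fun T : Clock => I.restrict T.1)
  rw [hfac, ← Measure.map_map hsum (measurable_increments τ),
    ← Measure.map_map hsum (measurable_increments τ),
    h τ hτ h0 (hk s (Finset.mem_insert_self _ _))]

/-- A probability measure on clocks with independent Poisson increments. -/
def IsPoissonClock (ρ : Measure Clock) : Prop :=
  ∀ τ : ℕ → ℝ≥0, Monotone τ →
    ρ.map (increments τ) = Measure.infinitePi fun i => poissonMeasure (τ (i + 1) - τ i)

/-- Along times that pass through `s`, each increment of the spliced clock is an increment of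
exactly one of the two independent clocks, over an interval of the same length. -/
theorem IsPoissonClock.measurePreserving_spliceClock {ρ : Measure Clock} [IsProbabilityMeasure ρ]
    (hρ : IsPoissonClock ρ) (s : ℝ≥0) :
    MeasurePreserving (fun p : Clock × Clock => spliceClock s p.1 p.2) (ρ.prod ρ) ρ := by
  refine ⟨measurable_spliceClock s, ?_⟩
  have := Measure.isProbabilityMeasure_map (μ := ρ.prod ρ) (measurable_spliceClock s).aemeasurable
  refine clock_measure_ext s fun τ hτ h0 ⟨m, hm⟩ => ?_
  set τ' : ℕ → ℝ≥0 := fun j => τ (m + j) - s with hτ'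
  have hτ'm : Monotone τ' := fun i j hij => tsub_le_tsub_right (hτ (by omega)) s
  set σ : ℕ → ℕ ⊕ ℕ := fun i => if i < m then Sum.inl i else Sum.inr (i - m) with hσ
  have hσi : Function.Injective σ := by
    intro a b hab
    simp only [hσ] at hab
    split_ifs at hab with h1 h2 h2
    · exact Sum.inl.inj hab
    · have := Sum.inr.inj hab
      omega
  have hmain := map_select_infinitePi (fun i => poissonMeasure (τ (i + 1) - τ i))
    (fun i => poissonMeasure (τ' (i + 1) - τ' i)) (fun i => poissonMeasure (τ (i + 1) - τ i))
    hσi (fun i => by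
      simp only [hσ]
      split_ifs with h1
      · rfl
      · have hs : s ≤ τ i := hm ▸ hτ (by omega)
        have e1 : m + (i - m) = i := by omega
        have e2 : m + (i - m + 1) = i + 1 := by omega
        simp only [Sum.elim_inr, hτ', e1, e2]
        rw [tsub_tsub_tsub_cancel_right hs])
  rw [hρ τ hτ, ← hmain, ← hρ τ hτ, ← hρ τ' hτ'm,
    Measure.map_prod_map _ _ (measurable_increments τ) (measurable_increments τ'),
    Measure.map_map (measurable_increments τ) (measurable_spliceClock s), Measure.map_map]
  · congr 1
    funext p i
    simp only [Function.comp_apply, hσ, Prod.map]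
    split_ifs with h1
    · have a1 : τ i ≤ s := hm ▸ hτ h1.le
      have a2 : τ (i + 1) ≤ s := hm ▸ hτ h1
      simp [increments, spliceClock, a1, a2, tsub_eq_zero_of_le, p.2.2.2]
    · have a1 : s ≤ τ i := hm ▸ hτ (by omega)
      have a2 : s ≤ τ (i + 1) := hm ▸ hτ (by omega)
      have e1 : m + (i - m) = i := by omega
      have e2 : m + (i - m + 1) = i + 1 := by omega
      simp [increments, spliceClock, a1, a2, hτ', e1, e2, Nat.add_sub_add_left]
  · refine measurable_pi_lambda _ fun i => ?_
    cases σ i with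
    | inl i => exact (measurable_pi_apply i).comp measurable_fst
    | inr i => exact (measurable_pi_apply i).comp measurable_snd
  · exact (measurable_increments τ).prodMap (measurable_increments τ')

/-- The law of a path is preserved by concatenation at time `s` with an independent path. -/
theorem IsPoissonClock.measurePreserving_splice {d : ℕ} {ρ : Measure Clock}
    [IsProbabilityMeasure ρ] (hρ : IsPoissonClock ρ) (lam : Measure (Site d))
    [IsProbabilityMeasure lam] (s : ℝ≥0) :
    MeasurePreserving (fun p : Path d × Path d => splice s p.1 p.2)
      ((ρ.prod (Measure.infinitePi fun _ : ℕ × ℕ => lam)).prod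
        (ρ.prod (Measure.infinitePi fun _ : ℕ × ℕ => lam)))
      (ρ.prod (Measure.infinitePi fun _ : ℕ × ℕ => lam)) := by
  have hg : Measurable (Function.uncurry fun (q : Clock × Clock) (w : Steps d × Steps d) =>
      spliceSteps (q.1.1 s) w.1 w.2) :=
    measurable_spliceSteps.comp
      (((measurable_clock_apply s).comp (measurable_fst.comp measurable_fst)).prodMk
        measurable_snd)
  -- The number of walks used by time `s` is random, but given the clocks it is a fixed `m`, and the
  -- renumbering preserves the law of the steps for every `m`.
  exact ((hρ.measurePreserving_spliceClock s).skew_product hg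
    (Filter.Eventually.of_forall fun q => map_spliceSteps lam (q.1.1 s))).comp
    (measurePreserving_prodProdProdComm ρ _ ρ _)

theorem IsPoissonClock.measure_eq_zero {ρ : Measure Clock} [IsProbabilityMeasure ρ]
    (hρ : IsPoissonClock ρ) (h : ℝ≥0) :
    ρ {T | T.1 h = 0} = ENNReal.ofReal (Real.exp (-h)) := by
  -- Along 0, h, h, ... the increment of index 0 is the number of arrivals up to `h`.
  set τ : ℕ → ℝ≥0 := fun i => if i = 0 then 0 else h with hτ
  have hτm : Monotone τ := by
    refine monotone_nat_of_le_succ fun n => ?_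
    rcases Nat.eq_zero_or_pos n with rfl | hn
    · simp [hτ]
    · simp [hτ, hn.ne']
  have hset : {T : Clock | T.1 h = 0} = increments τ ⁻¹' ((fun a : ℕ → ℕ => a 0) ⁻¹' {0}) := by
    ext T
    simp [increments, hτ, T.2.2]
  rw [hset, ← Measure.map_apply (measurable_increments τ)
    (measurable_pi_apply 0 (measurableSet_singleton 0)), hρ τ hτm,
    ← Measure.map_apply (measurable_pi_apply 0) (measurableSet_singleton 0),
    Measure.infinitePi_map_eval, poissonMeasure_singleton]
  simp [hτ]

/-! ### Covariance of functions that are minimal on a set of almost full measure -/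

theorem integrable_of_abs_le {α : Type*} [MeasurableSpace α] {ν : Measure α} [IsFiniteMeasure ν]
    {f : α → ℝ} (hf : AEStronglyMeasurable f ν) {M : ℝ} (hM : ∀ x, |f x| ≤ M) : Integrable f ν :=
  Integrable.of_bound hf M (Filter.Eventually.of_forall hM)

theorem integral_sub_le_of_eq_on {α : Type*} [MeasurableSpace α] {ν : Measure α}
    [IsProbabilityMeasure ν] {N : Set α} (hN : MeasurableSet N) {p M c : ℝ} (hp : ν.real Nᶜ ≤ p)
    {f : α → ℝ} (hf : Measurable f) (hfM : ∀ x, |f x| ≤ M) (hc : |c| ≤ M)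
    (hfN : ∀ x ∈ N, f x = c) : ∫ x, (f x - c) ∂ν ≤ 2 * M * p := by
  have hM : 0 ≤ M := (abs_nonneg c).trans hc
  calc ∫ x, (f x - c) ∂ν ≤ ∫ x, Nᶜ.indicator (fun _ => 2 * M) x ∂ν := by
        refine integral_mono
          ((integrable_of_abs_le hf.aestronglyMeasurable hfM).sub (integrable_const c))
          ((integrable_const _).indicator hN.compl) fun x => ?_
        by_cases hx : x ∈ N
        · simp [hx, hfN x hx]
        · simp only [Set.mem_compl_iff, hx, not_false_eq_true, Set.indicator_of_mem]
          linarith [(abs_le.1 (hfM x)).2, (abs_le.1 hc).1]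
    _ = 2 * M * ν.real Nᶜ := by
        rw [integral_indicator_const _ hN.compl, smul_eq_mul, mul_comm]
    _ ≤ 2 * M * p := by gcongr

theorem integral_mul_integral_le_of_eq_on {α : Type*} [MeasurableSpace α] {ν : Measure α}
    [IsProbabilityMeasure ν] {N : Set α} (hN : MeasurableSet N) {p M a b : ℝ}
    (hp : ν.real Nᶜ ≤ p) {f g : α → ℝ} (hf : Measurable f) (hg : Measurable g)
    (hfM : ∀ x, |f x| ≤ M) (hgM : ∀ x, |g x| ≤ M) (ha : |a| ≤ M) (hb : |b| ≤ M)
    (hfN : ∀ x ∈ N, f x = a) (hgN : ∀ x ∈ N, g x = b)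
    (hfa : ∀ᵐ x ∂ν, a ≤ f x) (hgb : ∀ᵐ x ∂ν, b ≤ g x) :
    (∫ x, f x ∂ν) * (∫ x, g x ∂ν) - (2 * M * p) ^ 2 ≤ ∫ x, f x * g x ∂ν := by
  have hfi : Integrable f ν := integrable_of_abs_le hf.aestronglyMeasurable hfM
  have hgi : Integrable g ν := integrable_of_abs_le hg.aestronglyMeasurable hgM
  have hfg : Integrable (fun x => f x * g x) ν :=
    integrable_of_abs_le (M := M * M) (hf.mul hg).aestronglyMeasurable fun x => by
      rw [abs_mul]
      exact mul_le_mul (hfM x) (hgM x) (abs_nonneg _) ((abs_nonneg _).trans ha)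
  have h1 := integral_sub_le_of_eq_on hN hp hf hfM ha hfN
  have h2 := integral_sub_le_of_eq_on hN hp hg hgM hb hgN
  have h1' : 0 ≤ ∫ x, (f x - a) ∂ν :=
    integral_nonneg_of_ae (hfa.mono fun x hx => sub_nonneg.2 hx)
  have h2' : 0 ≤ ∫ x, (g x - b) ∂ν :=
    integral_nonneg_of_ae (hgb.mono fun x hx => sub_nonneg.2 hx)
  have h3 : 0 ≤ ∫ x, (f x - a) * (g x - b) ∂ν := by
    refine integral_nonneg_of_ae ?_
    filter_upwards [hfa, hgb] with x hx hy using mul_nonneg (sub_nonneg.2 hx) (sub_nonneg.2 hy)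
  have e1 : ∫ x, (f x - a) ∂ν = ∫ x, f x ∂ν - a := by
    rw [integral_sub hfi (integrable_const a)]; simp
  have e2 : ∫ x, (g x - b) ∂ν = ∫ x, g x ∂ν - b := by
    rw [integral_sub hgi (integrable_const b)]; simp
  have e3 : ∫ x, (f x - a) * (g x - b) ∂ν =
      ∫ x, f x * g x ∂ν - a * ∫ x, g x ∂ν - b * ∫ x, f x ∂ν + a * b := by
    have : ∀ x, (f x - a) * (g x - b) = f x * g x - a * g x - b * f x + a * b := fun x => by ring
    simp only [this]
    have i1 : Integrable (fun x => f x * g x - a * g x) ν := hfg.sub (hgi.const_mul a)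
    have i2 : Integrable (fun x => f x * g x - a * g x - b * f x) ν := i1.sub (hfi.const_mul b)
    rw [integral_add i2 (integrable_const _), integral_sub i1 (hfi.const_mul b),
      integral_sub hfg (hgi.const_mul a), integral_const_mul, integral_const_mul]
    simp
  -- E[(f-a)(g-b)] equals E[fg] - E[f]E[g] + (E[f]-a)(E[g]-b), and the last product is at most
  -- (2Mp)².
  have h4 := mul_le_mul h1 h2 h2' (h1'.trans h1)
  rw [e1, e2] at h4
  rw [e3] at h3
  nlinarith

/-! ### Averaging over the future -/

/-- The mean of `f` over the continuations of `e` after time `s`. -/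
noncomputable def futureMean {d : ℕ} (ν : Measure (Path d)) (f : Path d → ℝ) (s : ℝ≥0)
    (e : Path d) : ℝ :=
  ∫ e', f (splice s e e') ∂ν

theorem futureMean_zero {d : ℕ} {ν : Measure (Path d)} {f : Path d → ℝ} (e : Path d) :
    futureMean ν f 0 e = ∫ e', f e' ∂ν := by
  simp only [futureMean, splice_zero]

theorem futureMean_splice_of_le {d : ℕ} {ν : Measure (Path d)} {f : Path d → ℝ}
    {s s' : ℝ≥0} (h : s ≤ s')
    (e e' : Path d) :
    futureMean ν f s (splice s' e e') = futureMean ν f s e := by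
  simp only [futureMean, splice_splice_of_le h]

section FutureMean

variable {d : ℕ} {ν : Measure (Path d)} [IsProbabilityMeasure ν] {f : Path d → ℝ} {M : ℝ}

theorem measurable_futureMean (hf : Measurable f) (s : ℝ≥0) : Measurable (futureMean ν f s) :=
  (StronglyMeasurable.integral_prod_right
    (f := fun e e' => f (splice s e e'))
    (hf.comp (measurable_splice s)).stronglyMeasurable).measurable

theorem abs_futureMean_le (hM : ∀ e, |f e| ≤ M) (s : ℝ≥0) (e : Path d) :
    |futureMean ν f s e| ≤ M := by
  have := norm_integral_le_of_norm_le_const (μ := ν) (f := fun e' => f (splice s e e')) (C := M)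
    (Filter.Eventually.of_forall fun e' => hM _)
  simpa [futureMean] using this

theorem measurable_splice_right (s : ℝ≥0) (e : Path d) : Measurable (splice s e) :=
  (measurable_splice s).comp measurable_prodMk_left

theorem measurable_splice_left (s : ℝ≥0) (e' : Path d) : Measurable fun e => splice s e e' :=
  (measurable_splice s).comp measurable_prodMk_right

theorem integral_integral_splice {h : ℝ≥0}
    (hν : MeasurePreserving (fun p : Path d × Path d => splice h p.1 p.2) (ν.prod ν) ν)
    (hf : Measurable f) (hM : ∀ e, |f e| ≤ M) :
    ∫ e, ∫ e', f (splice h e e') ∂ν ∂ν = ∫ e, f e ∂ν := by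
  rw [integral_integral (f := fun e e' => f (splice h e e'))
    (integrable_of_abs_le (hf.comp (measurable_splice h)).aestronglyMeasurable fun _ => hM _),
    ← hν.map_eq, integral_map (measurable_splice h).aemeasurable hf.aestronglyMeasurable]
  simp only [hν.map_eq]

theorem integral_futureMean_splice {s h : ℝ≥0}
    (hν : MeasurePreserving (fun p : Path d × Path d => splice h p.1 p.2) (ν.prod ν) ν)
    (hf : Measurable f) (hM : ∀ e, |f e| ≤ M) (e : Path d) :
    ∫ e', futureMean ν f (s + h) (splice s e e') ∂ν = futureMean ν f s e := by
  simp only [futureMean, splice_splice]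
  exact integral_integral_splice hν (f := fun e' => f (splice s e e'))
    (hf.comp (measurable_splice_right s e)) fun _ => hM _

end FutureMean

/-! ### One time block -/

/-- The constant `c` is the future mean after an arrival-free block. Since `F` is monotone but only
`Φ` is integrated, the past and the block must avoid the null sets on which the two disagree. -/
theorem ae_futureMean_ge {d : ℕ} {ν : Measure (Path d)} [IsProbabilityMeasure ν]
    (hν : ∀ s, MeasurePreserving (fun p : Path d × Path d => splice s p.1 p.2) (ν.prod ν) ν)
    {F Φ : History d → ℝ} (hF : Monotone F) (hΦ : Measurable Φ) {M : ℝ} (hM : ∀ x, |Φ x| ≤ M)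
    (hFΦ : ∀ᵐ e ∂ν, F (pathHistory e) = Φ (pathHistory e)) (s h : ℝ≥0)
    (h0 : ν {e | e.1.1 h = 0} ≠ 0) :
    ∀ᵐ e ∂ν, ∃ c, |c| ≤ M ∧
      (∀ᵐ e' ∂ν, c ≤ futureMean ν (fun e => Φ (pathHistory e)) (s + h) (splice s e e')) ∧
      ∀ e' : Path d, e'.1.1 h = 0 →
        futureMean ν (fun e => Φ (pathHistory e)) (s + h) (splice s e e') = c := by
  have h1 : ∀ᵐ e ∂ν, ∀ᵐ e'' ∂ν, F (pathHistory (splice (s + h) e e'')) =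
      Φ (pathHistory (splice (s + h) e e'')) :=
    Measure.ae_ae_of_ae_prod ((hν (s + h)).quasiMeasurePreserving.ae hFΦ)
  have h2 : ∀ᵐ e ∂ν, ∀ᵐ e' ∂ν, ∀ᵐ e'' ∂ν,
      F (pathHistory (splice (s + h) (splice s e e') e'')) =
        Φ (pathHistory (splice (s + h) (splice s e e') e'')) :=
    Measure.ae_ae_of_ae_prod ((hν s).quasiMeasurePreserving.ae h1)
  have hΦi : ∀ e : Path d, Integrable (fun e'' => Φ (pathHistory (splice (s + h) e e''))) ν :=
    fun e => integrable_of_abs_le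
      ((hΦ.comp measurable_pathHistory).comp (measurable_splice_right _ _)).aestronglyMeasurable
      fun _ => hM _
  filter_upwards [h2] with e he
  -- Arrival-free blocks have positive probability, so one of them lies outside the exceptional null
  -- set.
  obtain ⟨e₀, he₀, hgood⟩ : ∃ e₀ : Path d, e₀.1.1 h = 0 ∧ ∀ᵐ e'' ∂ν,
      F (pathHistory (splice (s + h) (splice s e e₀) e'')) =
        Φ (pathHistory (splice (s + h) (splice s e e₀) e'')) := by
    by_contra hcon
    refine h0 (measure_mono_null (fun e₀ he₀ => ?_) (ae_iff.1 he))
    exact fun hgood => hcon ⟨e₀, he₀, hgood⟩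
  refine ⟨futureMean ν (fun e => Φ (pathHistory e)) (s + h) (splice s e e₀),
    abs_futureMean_le (fun _ => hM _) _ _, ?_, ?_⟩
  · filter_upwards [he] with e' he'
    refine integral_mono_ae (hΦi _) (hΦi _) ?_
    filter_upwards [hgood, he'] with e'' h3 h4
    rw [← h3, ← h4]
    exact hF (pathHistory_splice_splice_le s h e e₀ e' e'' he₀)
  -- Two arrival-free blocks produce the same history, by comparison both ways; hence the equality
  -- is exact and needs no exceptional set.
  · intro e' he'
    simp only [futureMean]
    congr 1
    funext e''
    congr 1
    exact le_antisymm (pathHistory_splice_splice_le s h e e' e₀ e'' he')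
      (pathHistory_splice_splice_le s h e e₀ e' e'' he₀)

theorem integral_futureMean_mul_le {d : ℕ} {ν : Measure (Path d)} [IsProbabilityMeasure ν]
    (hν : ∀ s, MeasurePreserving (fun p : Path d × Path d => splice s p.1 p.2) (ν.prod ν) ν)
    {F G Φ Γ : History d → ℝ} (hF : Monotone F) (hG : Monotone G) (hΦ : Measurable Φ)
    (hΓ : Measurable Γ) {M : ℝ} (hΦM : ∀ x, |Φ x| ≤ M) (hΓM : ∀ x, |Γ x| ≤ M)
    (hFΦ : ∀ᵐ e ∂ν, F (pathHistory e) = Φ (pathHistory e))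
    (hGΓ : ∀ᵐ e ∂ν, G (pathHistory e) = Γ (pathHistory e)) (s h : ℝ≥0)
    (h0 : ν {e | e.1.1 h = 0} ≠ 0) (hp : ν.real {e | e.1.1 h = 0}ᶜ ≤ h) :
    ∫ e, futureMean ν (fun e => Φ (pathHistory e)) s e *
        futureMean ν (fun e => Γ (pathHistory e)) s e ∂ν - (2 * M * h) ^ 2 ≤
      ∫ e, futureMean ν (fun e => Φ (pathHistory e)) (s + h) e *
        futureMean ν (fun e => Γ (pathHistory e)) (s + h) e ∂ν := by
  set φ := fun e : Path d => Φ (pathHistory e) with hφ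
  set γ := fun e : Path d => Γ (pathHistory e) with hγ
  have hφm : Measurable φ := hΦ.comp measurable_pathHistory
  have hγm : Measurable γ := hΓ.comp measurable_pathHistory
  have hφM : ∀ e, |φ e| ≤ M := fun e => hΦM _
  have hγM : ∀ e, |γ e| ≤ M := fun e => hΓM _
  have hmul : ∀ s e, |futureMean ν φ s e * futureMean ν γ s e| ≤ M * M := fun s e => by
    rw [abs_mul]
    exact mul_le_mul (abs_futureMean_le hφM s e) (abs_futureMean_le hγM s e) (abs_nonneg _)
      ((abs_nonneg _).trans (hφM e))
  have hmm : ∀ s, Measurable fun e => futureMean ν φ s e * futureMean ν γ s e := fun s =>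
    (measurable_futureMean hφm s).mul (measurable_futureMean hγm s)
  have hN : MeasurableSet {e : Path d | e.1.1 h = 0} :=
    ((measurable_clock_apply h).comp measurable_fst) (measurableSet_singleton 0)
  -- Resampling the path after `s` turns the right side into an integral over the past `e`, so that
  -- the one-block inequality can be applied for almost every `e`.
  rw [← integral_integral_splice (hν s) (hmm (s + h)) (hmul (s + h))]
  have hconst : (2 * M * h) ^ 2 = ∫ _ : Path d, (2 * M * (h : ℝ)) ^ 2 ∂ν := by simp
  rw [hconst, ← integral_sub (integrable_of_abs_le (hmm s).aestronglyMeasurable (hmul s))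
    (integrable_const _)]
  refine integral_mono_ae ((integrable_of_abs_le (hmm s).aestronglyMeasurable (hmul s)).sub
    (integrable_const _)) ?_ ?_
  · refine integrable_of_abs_le (M := M * M)
      (measurable_futureMean (hmm (s + h)) s).aestronglyMeasurable fun e =>
        abs_futureMean_le (hmul (s + h)) s e
  · filter_upwards [ae_futureMean_ge hν hF hΦ hΦM hFΦ s h h0,
      ae_futureMean_ge hν hG hΓ hΓM hGΓ s h h0] with e ⟨a, haM, ha, ha'⟩ ⟨b, hbM, hb, hb'⟩
    -- By the tower property, the future mean at `s` is the average over the block of the future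
    -- mean at `s + h`.
    rw [← integral_futureMean_splice (s := s) (hν h) hφm hφM e,
      ← integral_futureMean_splice (s := s) (hν h) hγm hγM e]
    exact integral_mul_integral_le_of_eq_on hN hp
      ((measurable_futureMean hφm _).comp (measurable_splice_right s e))
      ((measurable_futureMean hγm _).comp (measurable_splice_right s e))
      (fun _ => abs_futureMean_le hφM _ _) (fun _ => abs_futureMean_le hγM _ _) haM hbM
      ha' hb' ha hb

/-! ### The filtration of the past -/

/-- The path without arrivals. -/
def voidPath (d : ℕ) : Path d := (⟨fun _ => 0, monotone_const, rfl⟩, fun _ => 0)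

/-- The `σ`-algebra generated by the path stopped at time `s`. -/
abbrev pastSpace (d : ℕ) (s : ℝ≥0) : MeasurableSpace (Path d) :=
  MeasurableSpace.comap (fun e => splice s e (voidPath d)) inferInstance

theorem pastSpace_le {d : ℕ} (s : ℝ≥0) : pastSpace d s ≤ Prod.instMeasurableSpace :=
  (measurable_splice_left s (voidPath d)).comap_le

theorem pastSpace_mono {d : ℕ} : Monotone (pastSpace d) := by
  intro s s' h
  rintro _ ⟨B, hB, rfl⟩
  refine ⟨_, measurable_splice_left s (voidPath d) hB, ?_⟩
  ext e
  simp only [Set.mem_preimage, splice_splice_of_le h]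

/-- The filtration of the past along an increasing sequence of times. -/
def pastFiltration (d : ℕ) {t : ℕ → ℝ≥0} (ht : Monotone t) :
    Filtration ℕ (Prod.instMeasurableSpace : MeasurableSpace (Path d)) where
  seq n := pastSpace d (t n)
  mono' := pastSpace_mono.comp ht
  le' n := pastSpace_le (t n)

theorem futureMean_ae_eq_condExp {d : ℕ} {ν : Measure (Path d)} [IsProbabilityMeasure ν]
    {s : ℝ≥0}
    (hν : MeasurePreserving (fun p : Path d × Path d => splice s p.1 p.2) (ν.prod ν) ν)
    {f : Path d → ℝ} (hf : Measurable f) {M : ℝ} (hM : ∀ e, |f e| ≤ M) :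
    futureMean ν f s =ᵐ[ν] ν[f | pastSpace d s] := by
  have hfi : Integrable f ν := integrable_of_abs_le hf.aestronglyMeasurable hM
  have hmi : Integrable (futureMean ν f s) ν :=
    integrable_of_abs_le (measurable_futureMean hf s).aestronglyMeasurable (abs_futureMean_le hM s)
  refine ae_eq_condExp_of_forall_setIntegral_eq (pastSpace_le s) hfi
    (fun _ _ _ => hmi.integrableOn) ?_ ?_
  · rintro B hB -
    have hB' : MeasurableSet B := pastSpace_le s B hB
    obtain ⟨C, -, rfl⟩ := hB
    set B := (fun e => splice s e (voidPath d)) ⁻¹' C with hBdef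
    rw [← integral_indicator hB', ← integral_indicator hB',
      ← integral_integral_splice (M := M) hν (hf.indicator hB') fun e => ?_]
    · refine integral_congr_ae (Filter.Eventually.of_forall fun e => ?_)
      -- An event of the past is unaffected by resampling after `s`, so its indicator leaves the
      -- inner integral.
      have hiff : ∀ e', splice s e e' ∈ B ↔ e ∈ B := fun e' => by
        simp only [hBdef, Set.mem_preimage, splice_splice_of_le le_rfl]
      by_cases he : e ∈ B
      · simp only [he, Set.indicator_of_mem, (hiff _).2 he, futureMean]
      · have he' : ∀ e', splice s e e' ∉ B := fun e' h => he ((hiff e').1 h)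
        simp [he, he']
    · by_cases he : e ∈ B
      · simpa [he] using hM e
      · simpa [he] using (abs_nonneg _).trans (hM e)
  · have hfac : futureMean ν f s = futureMean ν f s ∘ fun e => splice s e (voidPath d) := by
      funext e
      exact (futureMean_splice_of_le le_rfl e _).symm
    have : Measurable[pastSpace d s] (futureMean ν f s) := by
      rw [hfac]
      exact (measurable_futureMean hf s).comp (comap_measurable _)
    exact this.stronglyMeasurable.aestronglyMeasurable

/-- The cluster at a given time is determined by the path stopped at any later time. The history is
recovered in this way, but not the whole path: stopping erases walks that have not yet been used. -/
theorem measurable_pathHistory_iSup_past {d : ℕ} {t : ℕ → ℝ≥0}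
    (htop : Filter.Tendsto t Filter.atTop Filter.atTop) :
    Measurable[⨆ n, pastSpace d (t n)] (pathHistory (d := d)) := by
  refine @Measurable.subtype_mk _ _ (⨆ n, pastSpace d (t n)) _ _ _
    (@measurable_pi_lambda _ _ _ (⨆ n, pastSpace d (t n)) _ _ fun p => ?_) _
  obtain ⟨n, hn⟩ := (htop.eventually_ge_atTop p.1).exists
  refine Measurable.mono ?_ (le_iSup (fun n => pastSpace d (t n)) n) le_rfl
  have hfac : (fun e : Path d => (pathHistory e).1 p) =
      (fun e => (pathHistory e).1 p) ∘ fun e => splice (t n) e (voidPath d) := by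
    funext e
    have : clusterAt (splice (t n) e (voidPath d)) p.1 = clusterAt e p.1 := by
      rw [clusterAt_splice, min_eq_left hn, tsub_eq_zero_of_le hn, (voidPath d).1.2.2]
      rfl
    rw [Function.comp_apply, pathHistory_apply, pathHistory_apply, this]
  change Measurable[pastSpace d (t n)] fun e : Path d => (pathHistory e).1 p
  rw [hfac]
  exact ((measurable_pi_apply p).comp (measurable_subtype_coe.comp measurable_pathHistory)).comp
    (comap_measurable _)

/-- Lévy's upward theorem, applied to the future means as conditional expectations. -/
theorem ae_tendsto_futureMean {d : ℕ} {ν : Measure (Path d)} [IsProbabilityMeasure ν]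
    (hν : ∀ s, MeasurePreserving (fun p : Path d × Path d => splice s p.1 p.2) (ν.prod ν) ν)
    {Φ : History d → ℝ} (hΦ : Measurable Φ) {M : ℝ} (hM : ∀ x, |Φ x| ≤ M)
    {t : ℕ → ℝ≥0} (ht : Monotone t) (htop : Filter.Tendsto t Filter.atTop Filter.atTop) :
    ∀ᵐ e ∂ν, Filter.Tendsto (fun n => futureMean ν (fun e => Φ (pathHistory e)) (t n) e)
      Filter.atTop (nhds (Φ (pathHistory e))) := by
  have hφ : Measurable fun e : Path d => Φ (pathHistory e) := hΦ.comp measurable_pathHistory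
  have h1 := Integrable.tendsto_ae_condExp (ℱ := pastFiltration d ht) (μ := ν)
    (integrable_of_abs_le hφ.aestronglyMeasurable fun _ => hM _)
    (hΦ.comp (measurable_pathHistory_iSup_past htop)).stronglyMeasurable
  have h2 : ∀ᵐ e ∂ν, ∀ n, futureMean ν (fun e => Φ (pathHistory e)) (t n) e =
      (ν[fun e => Φ (pathHistory e) | pastSpace d (t n)]) e :=
    ae_all_iff.2 fun n => futureMean_ae_eq_condExp (hν (t n)) hφ fun _ => hM _
  filter_upwards [h1, h2] with e he1 he2
  simp only [he2]
  exact he1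

/-! ### Positive correlations of bounded functions -/

theorem integral_mul_integral_le_add {d : ℕ} {ν : Measure (Path d)} [IsProbabilityMeasure ν]
    (hν : ∀ s, MeasurePreserving (fun p : Path d × Path d => splice s p.1 p.2) (ν.prod ν) ν)
    (h0 : ∀ h : ℝ≥0, ν {e | e.1.1 h = 0} ≠ 0)
    (hp : ∀ h : ℝ≥0, ν.real {e | e.1.1 h = 0}ᶜ ≤ h)
    {F G Φ Γ : History d → ℝ} (hF : Monotone F) (hG : Monotone G) (hΦ : Measurable Φ)
    (hΓ : Measurable Γ) {M : ℝ} (hΦM : ∀ x, |Φ x| ≤ M) (hΓM : ∀ x, |Γ x| ≤ M)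
    (hFΦ : ∀ᵐ e ∂ν, F (pathHistory e) = Φ (pathHistory e))
    (hGΓ : ∀ᵐ e ∂ν, G (pathHistory e) = Γ (pathHistory e))
    {η : ℕ → ℝ≥0}
    (hη : Filter.Tendsto (fun n => ∑ i ∈ Finset.range n, η i) Filter.atTop Filter.atTop)
    {ε : ℝ} (hε : ∀ n, ∑ i ∈ Finset.range n, (2 * M * (η i : ℝ)) ^ 2 ≤ ε) :
    (∫ e, Φ (pathHistory e) ∂ν) * (∫ e, Γ (pathHistory e) ∂ν) - ε ≤
      ∫ e, Φ (pathHistory e) * Γ (pathHistory e) ∂ν := by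
  set t : ℕ → ℝ≥0 := fun n => ∑ i ∈ Finset.range n, η i with ht
  have htm : Monotone t := monotone_nat_of_le_succ fun n => by
    simp only [ht, Finset.sum_range_succ]
    exact le_self_add
  have hφm : Measurable fun e : Path d => Φ (pathHistory e) := hΦ.comp measurable_pathHistory
  have hγm : Measurable fun e : Path d => Γ (pathHistory e) := hΓ.comp measurable_pathHistory
  have hstep : ∀ n, (∫ e, Φ (pathHistory e) ∂ν) * (∫ e, Γ (pathHistory e) ∂ν) -
      ∑ i ∈ Finset.range n, (2 * M * (η i : ℝ)) ^ 2 ≤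
      ∫ e, futureMean ν (fun e => Φ (pathHistory e)) (t n) e *
        futureMean ν (fun e => Γ (pathHistory e)) (t n) e ∂ν := by
    intro n
    induction n with
    -- At time 0 the future means are constants, so the induction starts from the product of the two
    -- expectations.
    | zero => simp [ht, futureMean_zero]
    | succ n ih =>
      have htn : t (n + 1) = t n + η n := Finset.sum_range_succ _ _
      rw [Finset.sum_range_succ, htn]
      have := integral_futureMean_mul_le hν hF hG hΦ hΓ hΦM hΓM hFΦ hGΓ (t n) (η n) (h0 _) (hp _)
      linarith
  have hlim : Filter.Tendsto (fun n => ∫ e, futureMean ν (fun e => Φ (pathHistory e)) (t n) e *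
        futureMean ν (fun e => Γ (pathHistory e)) (t n) e ∂ν) Filter.atTop
      (nhds (∫ e, Φ (pathHistory e) * Γ (pathHistory e) ∂ν)) := by
    refine tendsto_integral_of_dominated_convergence (fun _ => M * M) (fun n =>
      ((measurable_futureMean hφm _).mul (measurable_futureMean hγm _)).aestronglyMeasurable)
      (integrable_const _) (fun n => Filter.Eventually.of_forall fun e => ?_) ?_
    · rw [norm_mul]
      exact mul_le_mul (abs_futureMean_le (fun _ => hΦM _) _ _)
        (abs_futureMean_le (fun _ => hΓM _) _ _) (norm_nonneg _)
        ((abs_nonneg _).trans (hΦM (pathHistory e)))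
    · filter_upwards [ae_tendsto_futureMean hν hΦ hΦM htm hη,
        ae_tendsto_futureMean hν hΓ hΓM htm hη] with e h1 h2 using h1.mul h2
  refine ge_of_tendsto' hlim fun n => ?_
  linarith [hstep n, hε n]

theorem integral_mul_integral_le {d : ℕ} {ν : Measure (Path d)} [IsProbabilityMeasure ν]
    (hν : ∀ s, MeasurePreserving (fun p : Path d × Path d => splice s p.1 p.2) (ν.prod ν) ν)
    (h0 : ∀ h : ℝ≥0, ν {e | e.1.1 h = 0} ≠ 0)
    (hp : ∀ h : ℝ≥0, ν.real {e | e.1.1 h = 0}ᶜ ≤ h)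
    {F G Φ Γ : History d → ℝ} (hF : Monotone F) (hG : Monotone G) (hΦ : Measurable Φ)
    (hΓ : Measurable Γ) {M : ℝ} (hΦM : ∀ x, |Φ x| ≤ M) (hΓM : ∀ x, |Γ x| ≤ M)
    (hFΦ : ∀ᵐ e ∂ν, F (pathHistory e) = Φ (pathHistory e))
    (hGΓ : ∀ᵐ e ∂ν, G (pathHistory e) = Γ (pathHistory e)) :
    (∫ e, Φ (pathHistory e) ∂ν) * (∫ e, Γ (pathHistory e) ∂ν) ≤
      ∫ e, Φ (pathHistory e) * Γ (pathHistory e) ∂ν := by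
  set K : ℝ := ∑' i : ℕ, 1 / ((i : ℝ) + 1) ^ 2 with hK
  have hsum : Summable fun i : ℕ => 1 / ((i : ℝ) + 1) ^ 2 := by
    have := (summable_nat_add_iff 1).2 (Real.summable_one_div_nat_pow.2 (by norm_num : 1 < 2))
    simpa using this
  have hbound : ∀ c : ℝ≥0, 0 < c →
      (∫ e, Φ (pathHistory e) ∂ν) * (∫ e, Γ (pathHistory e) ∂ν) - (2 * M * c) ^ 2 * K ≤
        ∫ e, Φ (pathHistory e) * Γ (pathHistory e) ∂ν := by
    intro c hc
    refine integral_mul_integral_le_add hν h0 hp hF hG hΦ hΓ hΦM hΓM hFΦ hGΓ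
      -- The harmonic series diverges, so the blocks cover all times, while the squares sum to at
      -- most c² K.
      (η := fun i => c * (1 / ((i : ℝ≥0) + 1))) ?_ fun n => ?_
    · rw [← NNReal.tendsto_coe_atTop]
      have : (fun n => ((∑ i ∈ Finset.range n, c * (1 / ((i : ℝ≥0) + 1)) : ℝ≥0) : ℝ)) =
          fun n => (c : ℝ) * ∑ i ∈ Finset.range n, 1 / ((i : ℝ) + 1) := by
        funext n
        push_cast
        rw [Finset.mul_sum]
      rw [this]
      exact Real.tendsto_sum_range_one_div_nat_succ_atTop.const_mul_atTop (by exact_mod_cast hc)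
    · have : ∀ i : ℕ, (2 * M * ((c * (1 / ((i : ℝ≥0) + 1)) : ℝ≥0) : ℝ)) ^ 2 =
          (2 * M * c) ^ 2 * (1 / ((i : ℝ) + 1) ^ 2) := fun i => by
        push_cast
        field_simp
      simp only [this]
      rw [← Finset.mul_sum]
      exact mul_le_mul_of_nonneg_left (hsum.sum_le_tsum _ fun i _ => by positivity) (sq_nonneg _)
  have hlim : Filter.Tendsto (fun n : ℕ => (∫ e, Φ (pathHistory e) ∂ν) *
      (∫ e, Γ (pathHistory e) ∂ν) - (2 * M * (1 / ((n : ℝ) + 1))) ^ 2 * K) Filter.atTop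
      (nhds ((∫ e, Φ (pathHistory e) ∂ν) * (∫ e, Γ (pathHistory e) ∂ν) -
        (2 * M * 0) ^ 2 * K)) :=
    tendsto_const_nhds.sub
      (((tendsto_one_div_add_atTop_nhds_zero_nat.const_mul (2 * M)).pow 2).mul_const K)
  have := le_of_tendsto' hlim fun n => by
    simpa using hbound (1 / ((n : ℝ≥0) + 1)) (by positivity)
  simpa using this

/-! ### The law of the driving data -/

/-- The path given by a Poisson process and the steps of the walks. -/
def toPath {S : Type*} [MeasurableSpace S] {μ : Measure S} {d : ℕ} {T : ℝ≥0 → S → ℕ}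
    (hT : IsPoissonProcess T μ) (X : ℕ → ℕ → S → Site d) (ω : S) : Path d :=
  (⟨fun t => T t ω, hT.monotone ω, hT.zero ω⟩, fun p => X p.1 p.2 ω)

theorem measurable_toPath_fst {S : Type*} [MeasurableSpace S] {μ : Measure S} {d : ℕ}
    {T : ℝ≥0 → S → ℕ} (hT : IsPoissonProcess T μ) (X : ℕ → ℕ → S → Site d) :
    Measurable fun ω => (toPath hT X ω).1 :=
  Measurable.subtype_mk (measurable_pi_lambda _ hT.measurable)

theorem isPoissonClock_map {S : Type*} [MeasurableSpace S] {μ : Measure S}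
    {d : ℕ} {T : ℝ≥0 → S → ℕ} (hT : IsPoissonProcess T μ)
    (X : ℕ → ℕ → S → Site d) : IsPoissonClock (μ.map fun ω => (toPath hT X ω).1) := by
  intro τ hτ
  rw [Measure.map_map (measurable_increments τ) (measurable_toPath_fst hT X)]
  refine (iIndepFun.hasLaw_infinitePi (fun i => hT.hasLaw_increment _ _ (hτ i.le_succ))
    (hT.hasIndepIncrements.nat hτ) ?_).map_eq
  exact (measurable_pi_lambda _ fun i =>
    (hT.measurable _).sub (hT.measurable _)).aemeasurable

theorem map_toPath_eq_prod {S : Type*} [MeasurableSpace S] {μ : Measure S}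
    [IsProbabilityMeasure μ] {d : ℕ} {T : ℝ≥0 → S → ℕ} (hT : IsPoissonProcess T μ)
    {X : ℕ → ℕ → S → Site d} (hX : IsSimpleWalkSteps X μ)
    (hTX : IndepFun (fun ω t => T t ω) (fun ω (p : ℕ × ℕ) => X p.1 p.2 ω) μ) :
    μ.map (toPath hT X) = (μ.map fun ω => (toPath hT X ω).1).prod
      (Measure.infinitePi fun _ : ℕ × ℕ => uniformOn (unitSteps d)) := by
  have hXm : Measurable fun ω (p : ℕ × ℕ) => X p.1 p.2 ω :=
    measurable_pi_lambda _ fun p => hX.measurable p.1 p.2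
  have hind : IndepFun (fun ω => (toPath hT X ω).1) (fun ω => (toPath hT X ω).2) μ := by
    rw [IndepFun_iff_Indep] at hTX ⊢
    convert hTX using 1
    · exact MeasurableSpace.comap_comp
    · rfl
  have h := (indepFun_iff_map_prod_eq_prod_map_map
    (measurable_toPath_fst hT X).aemeasurable hXm.aemeasurable).1 hind
  rw [← (iIndepFun.hasLaw_infinitePi (fun p : ℕ × ℕ => hX.hasLaw p.1 p.2) hX.iIndepFun
    hXm.aemeasurable).map_eq]
  exact h

theorem measurable_toPath {S : Type*} [MeasurableSpace S] {μ : Measure S} {d : ℕ}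
    {T : ℝ≥0 → S → ℕ} (hT : IsPoissonProcess T μ) {X : ℕ → ℕ → S → Site d}
    (hX : IsSimpleWalkSteps X μ) : Measurable (toPath hT X) :=
  (measurable_toPath_fst hT X).prodMk (measurable_pi_lambda _ fun p => hX.measurable p.1 p.2)

/-! ### Truncation -/

/-- Truncation of a real number to `[-n, n]`. -/
noncomputable def trunc (n : ℕ) (x : ℝ) : ℝ := max (-n) (min x n)

theorem monotone_trunc (n : ℕ) : Monotone (trunc n) := fun _ _ h =>
  max_le_max le_rfl (min_le_min_right _ h)

theorem measurable_trunc (n : ℕ) : Measurable (trunc n) := (monotone_trunc n).measurable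

theorem abs_trunc_le (n : ℕ) (x : ℝ) : |trunc n x| ≤ n := by
  have : (0 : ℝ) ≤ n := n.cast_nonneg
  exact abs_le.2 ⟨le_max_left _ _, max_le (by linarith) (min_le_right _ _)⟩

theorem trunc_of_abs_le {n : ℕ} {x : ℝ} (h : |x| ≤ n) : trunc n x = x := by
  rw [trunc, min_eq_left (abs_le.1 h).2, max_eq_right (abs_le.1 h).1]

theorem abs_trunc_le_abs (n : ℕ) (x : ℝ) : |trunc n x| ≤ |x| := by
  rcases le_total |x| n with h | h
  · rw [trunc_of_abs_le h]
  · exact (abs_trunc_le n x).trans h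

theorem tendsto_trunc (x : ℝ) :
    Filter.Tendsto (fun n => trunc n x) Filter.atTop (nhds x) := by
  obtain ⟨N, hN⟩ := exists_nat_ge |x|
  refine tendsto_const_nhds.congr' ?_
  filter_upwards [Filter.eventually_ge_atTop N] with n hn
  exact (trunc_of_abs_le (hN.trans (by exact_mod_cast hn))).symm

theorem tendsto_integral_trunc {S : Type*} [MeasurableSpace S] {μ : Measure S} {f : S → ℝ}
    (hf : Integrable f μ) : Filter.Tendsto (fun n => ∫ ω, trunc n (f ω) ∂μ) Filter.atTop
      (nhds (∫ ω, f ω ∂μ)) :=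
  tendsto_integral_of_dominated_convergence (fun ω => |f ω|)
    (fun n => ((measurable_trunc n).comp_aemeasurable hf.aemeasurable).aestronglyMeasurable)
    hf.abs (fun n => Filter.Eventually.of_forall fun _ => abs_trunc_le_abs n _)
    (Filter.Eventually.of_forall fun _ => tendsto_trunc _)

theorem tendsto_integral_trunc_mul {S : Type*} [MeasurableSpace S] {μ : Measure S} {f g : S → ℝ}
    (hf : AEMeasurable f μ) (hg : AEMeasurable g μ) (hfg : Integrable (fun ω => f ω * g ω) μ) :
    Filter.Tendsto (fun n => ∫ ω, trunc n (f ω) * trunc n (g ω) ∂μ) Filter.atTop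
      (nhds (∫ ω, f ω * g ω ∂μ)) := by
  refine tendsto_integral_of_dominated_convergence (fun ω => |f ω * g ω|)
    (fun n => (((measurable_trunc n).comp_aemeasurable hf).mul
      ((measurable_trunc n).comp_aemeasurable hg)).aestronglyMeasurable)
    hfg.abs (fun n => Filter.Eventually.of_forall fun ω => ?_)
    (Filter.Eventually.of_forall fun ω => (tendsto_trunc _).mul (tendsto_trunc _))
  rw [Real.norm_eq_abs, abs_mul, abs_mul]
  exact mul_le_mul (abs_trunc_le_abs n _) (abs_trunc_le_abs n _) (abs_nonneg _) (abs_nonneg _)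

/-- Truncation is increasing, so the bounded case applies to the truncated functions on path space,
with the measurable versions of `F` and `G` under the integrals. -/
theorem integral_trunc_mul_integral_trunc_le {S : Type*} [MeasurableSpace S] {μ : Measure S}
    [IsProbabilityMeasure μ] {d : ℕ} {T : ℝ≥0 → S → ℕ} (hT : IsPoissonProcess T μ)
    {X : ℕ → ℕ → S → Site d} (hX : IsSimpleWalkSteps X μ)
    (hTX : IndepFun (fun ω t => T t ω) (fun ω (p : ℕ × ℕ) => X p.1 p.2 ω) μ)
    {F G : History d → ℝ} (hF : Monotone F) (hG : Monotone G)
    (hFm : AEMeasurable F (μ.map (history T hT.monotone X)))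
    (hGm : AEMeasurable G (μ.map (history T hT.monotone X))) (n : ℕ) :
    (∫ ω, trunc n (F (history T hT.monotone X ω)) ∂μ) *
        (∫ ω, trunc n (G (history T hT.monotone X ω)) ∂μ) ≤
      ∫ ω, trunc n (F (history T hT.monotone X ω)) *
        trunc n (G (history T hT.monotone X ω)) ∂μ := by
  have hhm : Measurable (history T hT.monotone X) :=
    measurable_history _ hT.measurable hX.measurable
  have hpm : Measurable (toPath hT X) := measurable_toPath hT hX
  have hρ := isPoissonClock_map hT X
  have hρ1 : IsProbabilityMeasure (μ.map fun ω => (toPath hT X ω).1) :=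
    Measure.isProbabilityMeasure_map (measurable_toPath_fst hT X).aemeasurable
  have hlam : IsProbabilityMeasure (uniformOn (unitSteps d)) := by
    rw [← (hX.hasLaw 0 0).map_eq]
    exact Measure.isProbabilityMeasure_map (hX.measurable 0 0).aemeasurable
  have hν1 : IsProbabilityMeasure (μ.map (toPath hT X)) :=
    Measure.isProbabilityMeasure_map hpm.aemeasurable
  have hν : ∀ s, MeasurePreserving (fun p : Path d × Path d => splice s p.1 p.2)
      ((μ.map (toPath hT X)).prod (μ.map (toPath hT X))) (μ.map (toPath hT X)) := by
    rw [map_toPath_eq_prod hT hX hTX]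
    exact hρ.measurePreserving_splice _
  have hNm : ∀ h : ℝ≥0, MeasurableSet {e : Path d | e.1.1 h = 0} := fun h =>
    ((measurable_clock_apply h).comp measurable_fst) (measurableSet_singleton 0)
  have hN : ∀ h : ℝ≥0, μ.map (toPath hT X) {e | e.1.1 h = 0} =
      ENNReal.ofReal (Real.exp (-h)) := fun h => by
    rw [← hρ.measure_eq_zero h, Measure.map_apply hpm (hNm h)]
    exact (Measure.map_apply (measurable_toPath_fst hT X)
      (measurable_clock_apply h (measurableSet_singleton 0))).symm
  have h0 : ∀ h : ℝ≥0, μ.map (toPath hT X) {e | e.1.1 h = 0} ≠ 0 := fun h => by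
    rw [hN h]
    simpa using Real.exp_pos _
  have hp : ∀ h : ℝ≥0, (μ.map (toPath hT X)).real {e | e.1.1 h = 0}ᶜ ≤ h := fun h => by
    rw [probReal_compl_eq_one_sub (hNm h), measureReal_def, hN h,
      ENNReal.toReal_ofReal (Real.exp_pos _).le]
    -- The probability of some arrival is 1 - exp(-h) ≤ h.
    linarith [Real.add_one_le_exp (-(h : ℝ))]
  have hae : ∀ {H : History d → ℝ} (hH : AEMeasurable H (μ.map (history T hT.monotone X))),
      ∀ᵐ ω ∂μ, H (history T hT.monotone X ω) = hH.mk H (history T hT.monotone X ω) :=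
    fun hH => ae_of_ae_map hhm.aemeasurable hH.ae_eq_mk
  have hmap : μ.map (history T hT.monotone X) = (μ.map (toPath hT X)).map pathHistory := by
    rw [Measure.map_map measurable_pathHistory hpm]
    rfl
  have hae' : ∀ {H : History d → ℝ} (hH : AEMeasurable H (μ.map (history T hT.monotone X))),
      ∀ᵐ e ∂μ.map (toPath hT X), trunc n (H (pathHistory e)) =
        trunc n (hH.mk H (pathHistory e)) := fun {H} hH => by
    have : ∀ᵐ x ∂(μ.map (toPath hT X)).map pathHistory, H x = hH.mk H x := by
      rw [← hmap]
      exact hH.ae_eq_mk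
    filter_upwards [ae_of_ae_map measurable_pathHistory.aemeasurable this] with e he
    rw [he]
  have key := integral_mul_integral_le hν h0 hp ((monotone_trunc n).comp hF)
    ((monotone_trunc n).comp hG) ((measurable_trunc n).comp hFm.measurable_mk)
    ((measurable_trunc n).comp hGm.measurable_mk) (fun _ => abs_trunc_le n _)
    (fun _ => abs_trunc_le n _) (hae' hFm) (hae' hGm)
  have hΦ : Measurable fun e : Path d => (trunc n ∘ hFm.mk F) (pathHistory e) :=
    ((measurable_trunc n).comp hFm.measurable_mk).comp measurable_pathHistory
  have hΓ : Measurable fun e : Path d => (trunc n ∘ hGm.mk G) (pathHistory e) :=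
    ((measurable_trunc n).comp hGm.measurable_mk).comp measurable_pathHistory
  have hΦΓ : Measurable fun e : Path d =>
      (trunc n ∘ hFm.mk F) (pathHistory e) * (trunc n ∘ hGm.mk G) (pathHistory e) := hΦ.mul hΓ
  rw [integral_map hpm.aemeasurable hΦ.aestronglyMeasurable,
    integral_map hpm.aemeasurable hΓ.aestronglyMeasurable,
    integral_map hpm.aemeasurable hΦΓ.aestronglyMeasurable] at key
  have e1 : ∫ ω, trunc n (F (history T hT.monotone X ω)) ∂μ =
      ∫ ω, trunc n (hFm.mk F (history T hT.monotone X ω)) ∂μ :=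
    integral_congr_ae ((hae hFm).mono fun ω hω => congrArg (trunc n) hω)
  have e2 : ∫ ω, trunc n (G (history T hT.monotone X ω)) ∂μ =
      ∫ ω, trunc n (hGm.mk G (history T hT.monotone X ω)) ∂μ :=
    integral_congr_ae ((hae hGm).mono fun ω hω => congrArg (trunc n) hω)
  have e3 : ∫ ω, trunc n (F (history T hT.monotone X ω)) *
        trunc n (G (history T hT.monotone X ω)) ∂μ =
      ∫ ω, trunc n (hFm.mk F (history T hT.monotone X ω)) *
        trunc n (hGm.mk G (history T hT.monotone X ω)) ∂μ := by
    refine integral_congr_ae ?_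
    filter_upwards [hae hFm, hae hGm] with ω h1 h2
    rw [h1, h2]
  rw [e1, e2, e3]
  exact key

end IDLA

theorem theorem1p1 {d : ℕ} (hd : 1 ≤ d) {S : Type*} [MeasurableSpace S] (μ : Measure S)
    [IsProbabilityMeasure μ] (T : ℝ≥0 → S → ℕ) (X : ℕ → ℕ → S → IDLA.Site d)
    (hT : IDLA.IsPoissonProcess T μ) (hX : IDLA.IsSimpleWalkSteps X μ)
    (hTX : IndepFun (fun ω t => T t ω) (fun ω (p : ℕ × ℕ) => X p.1 p.2 ω) μ)
    (F G : IDLA.History d → ℝ) (hF : Monotone F) (hG : Monotone G)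
    (hF2 : MemLp F 2 (μ.map (IDLA.history T hT.monotone X)))
    (hG2 : MemLp G 2 (μ.map (IDLA.history T hT.monotone X))) :
    0 ≤ cov[fun ω => F (IDLA.history T hT.monotone X ω),
      fun ω => G (IDLA.history T hT.monotone X ω); μ] := by
  have hhm : Measurable (IDLA.history T hT.monotone X) :=
    IDLA.measurable_history _ hT.measurable hX.measurable
  have hf : MemLp (fun ω => F (IDLA.history T hT.monotone X ω)) 2 μ :=
    hF2.comp_of_map hhm.aemeasurable
  have hg : MemLp (fun ω => G (IDLA.history T hT.monotone X ω)) 2 μ :=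
    hG2.comp_of_map hhm.aemeasurable
  rw [covariance_eq_sub hf hg, sub_nonneg]
  -- Square integrability makes the product integrable, so dominated convergence removes the
  -- truncation on both sides.
  exact le_of_tendsto_of_tendsto'
    ((IDLA.tendsto_integral_trunc (hf.integrable one_le_two)).mul
      (IDLA.tendsto_integral_trunc (hg.integrable one_le_two)))
    (IDLA.tendsto_integral_trunc_mul hf.aemeasurable hg.aemeasurable (hf.integrable_mul hg))
    (IDLA.integral_trunc_mul_integral_trunc_le hT hX hTX hF hG hF2.aemeasurable hG2.aemeasurable)
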